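/- A permutation $\pi=\pi_1\cdots\pi_n$ of $[n]$ is called cyclic if its cycle decomposition is a single cycle of length $n$. Write $\mathcal C_n(321)$ for the set of cyclic permutations of $[n]$ that avoid the pattern $321$, i.e. for which there are no $i<j<k$ with $\pi_i>\pi_j>\pi_k$. The fundamental bijection $\theta$ on the permutations of $[n]$ is defined as follows: write $\pi$ as a product of disjoint cycles (including fixed points), each cycle written with its largest element first (as $(m,\pi(m),\pi(\pi(m)),\dots)$), the cycles ordered by increasing largest element; removing the parentheses gives the one-line notation of $\theta(\pi)$. A vincular pattern is a permutation some of whose entries are underbraced. An occurrence of it in $\tau=\tau_1\cdots\tau_m$ is a subword of $\tau$ in the same relative order as the pattern, such that entries in a common underbrace are adjacent in $\tau$, and such that if the first (resp. last) letter of the pattern forms an underbrace on its own, the corresponding entry is $\tau_1$ (resp. $\tau_m$). Let $\mathcal A_m$ be the set of permutations of $[m]$ with no occurrence of any of the six vincular patterns $$\underbrace{32}\,\underbrace{41},\quad \underbrace{14}\,\underbrace{23},\quad \underbrace{41}\,\underbrace{32},\quad \underbrace{23}\,\underbrace{14},\quad \underbrace{23}\,\underbrace{1},\quad \underbrace{1}\,\underbrace{32}.$$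 Then for every $n\ge 2$, $$|\mathcal C_n(321)| = |\mathcal A_{n-1}|.$$ Moreover, for every $\pi\in\mathcal C_n(321)$ the one-line notation of $\theta(\pi)$ starts with $n$, and deleting this $n$ gives a bijection from $\mathcal C_n(321)$ onto $\mathcal A_{n-1}$. -/

import Mathlib

namespace CyclicAvoid

/-- The one-line notation `π₁ π₂ … πₙ` of a permutation, as a word in `1, …, n`
(`Fin n` is `0, …, n - 1`, so the letters are shifted by one). -/
def oneLine {n : ℕ} (π : Equiv.Perm (Fin n)) : List ℕ :=
  List.ofFn fun i => (π i : ℕ) + 1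

/-- A permutation of length `n` is cyclic if its cycle form is one single cycle, which then
moves through all of `1, …, n`. -/
def IsCyclic {n : ℕ} (π : Equiv.Perm (Fin n)) : Prop :=
  π.IsCycleOn Set.univ

/-! ### Patterns -/

/-- The positions `e 0 < e 1 < … < e (k - 1)` of `π` carry a subword that is order isomorphic
to the word `w`. -/
def IsOccurrence {k n : ℕ} (w : Fin k → ℕ) (π : Equiv.Perm (Fin n)) (e : Fin k → Fin n) : Prop :=
  StrictMono e ∧ ∀ r s : Fin k, π (e r) < π (e s) ↔ w r < w s

/-- Classical pattern containment. -/
def Contains {k n : ℕ} (π : Equiv.Perm (Fin n)) (w : Fin k → ℕ) : Prop :=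
  ∃ e : Fin k → Fin n, IsOccurrence w π e

/-- A vincular pattern of length `k`: the word of a permutation of `1, …, k` together with the
adjacency conditions expressed by the underbrackets. For `r` a position, `adj` contains `r` when
the letters at the positions `r` and `r + 1` (counted from `0`) are in the same underbracket.
`first` (resp. `last`) says that the first (resp. last) letter of the pattern alone is
underbracketed, and so has to be the first (resp. last) entry of the permutation. -/
structure VincularPattern (k : ℕ) where
  word : Fin k → ℕ
  isPerm : Finset.univ.image word = Finset.Icc 1 k
  adj : Finset ℕ
  first : Bool
  last : Bool

/-- `π` contains the vincular pattern `p`. -/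
def ContainsVincular {k n : ℕ} (π : Equiv.Perm (Fin n)) (p : VincularPattern k) : Prop :=
  ∃ e : Fin k → Fin n, IsOccurrence p.word π e ∧
    (∀ r s : Fin k, (s : ℕ) = r + 1 → (r : ℕ) ∈ p.adj → (e s : ℕ) = e r + 1) ∧
    (p.first = true → ∀ r : Fin k, (r : ℕ) = 0 → (e r : ℕ) = 0) ∧
    (p.last = true → ∀ r : Fin k, (r : ℕ) + 1 = k → (e r : ℕ) + 1 = n)

/-- `[32] [41]` (square brackets for underbrackets). -/
def p32_41 : VincularPattern 4 := ⟨![3, 2, 4, 1], by decide, {0, 2}, false, false⟩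

/-- `[14] [23]`. -/
def p14_23 : VincularPattern 4 := ⟨![1, 4, 2, 3], by decide, {0, 2}, false, false⟩

/-- `[41] [32]`. -/
def p41_32 : VincularPattern 4 := ⟨![4, 1, 3, 2], by decide, {0, 2}, false, false⟩

/-- `[23] [14]`. -/
def p23_14 : VincularPattern 4 := ⟨![2, 3, 1, 4], by decide, {0, 2}, false, false⟩

/-- `[23] [1]`: the letter `1` is the last entry of the permutation. -/
def p23_1 : VincularPattern 3 := ⟨![2, 3, 1], by decide, {0}, false, true⟩

/-- `[1] [32]`: the letter `1` is the first entry of the permutation. -/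
def p1_32 : VincularPattern 3 := ⟨![1, 3, 2], by decide, {1}, true, false⟩

/-- The cyclic permutations of length `n` that avoid `321`. -/
def cyclicAvoid321 (n : ℕ) : Set (Equiv.Perm (Fin n)) :=
  {π | IsCyclic π ∧ ¬ Contains π ![3, 2, 1]}

/-- The permutations of length `n` that avoid the six vincular patterns. -/
def avoidSix (n : ℕ) : Set (Equiv.Perm (Fin n)) :=
  {τ | ¬ ContainsVincular τ p32_41 ∧ ¬ ContainsVincular τ p14_23 ∧
    ¬ ContainsVincular τ p41_32 ∧ ¬ ContainsVincular τ p23_14 ∧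
    ¬ ContainsVincular τ p23_1 ∧ ¬ ContainsVincular τ p1_32}

/-! ### The fundamental bijection -/

/-- The largest elements of the cycles of `π` (fixed points included), in increasing order. -/
def cycleMaxima {n : ℕ} (π : Equiv.Perm (Fin n)) : List (Fin n) :=
  (List.finRange n).filter fun m => ∀ x : Fin n, π.SameCycle m x → x ≤ m

/-- The cycle of `π` through `m`, written from `m` on: `m, π m, π (π m), …`. Mathlib's `toList`
is empty at a fixed point, where the cycle is `(m)`. -/
def cycleFrom {n : ℕ} (π : Equiv.Perm (Fin n)) (m : Fin n) : List (Fin n) :=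
  if π m = m then [m] else π.toList m

/-- The standard cycle notation of `π` (every cycle starts with its largest element, cycles are
ordered by their largest elements) with the parentheses removed. -/
def thetaList {n : ℕ} (π : Equiv.Perm (Fin n)) : List (Fin n) :=
  (cycleMaxima π).flatMap (cycleFrom π)

theorem mem_cycleFrom {n : ℕ} (π : Equiv.Perm (Fin n)) (m x : Fin n) :
    x ∈ cycleFrom π m ↔ π.SameCycle m x := by
  unfold cycleFrom
  split_ifs with h
  · rw [List.mem_singleton, Equiv.Perm.sameCycle_comm]
    constructor
    · rintro rfl
      exact Equiv.Perm.SameCycle.refl _ _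
    · intro hs
      exact (hs.eq_of_right h)
  · rw [Equiv.Perm.mem_toList_iff, Equiv.Perm.mem_support]
    exact ⟨fun hx => hx.1, fun hx => ⟨hx, h⟩⟩

theorem nodup_cycleFrom {n : ℕ} (π : Equiv.Perm (Fin n)) (m : Fin n) :
    (cycleFrom π m).Nodup := by
  unfold cycleFrom
  split_ifs
  · exact List.nodup_singleton _
  · exact Equiv.Perm.nodup_toList _ _

theorem mem_cycleMaxima {n : ℕ} (π : Equiv.Perm (Fin n)) (m : Fin n) :
    m ∈ cycleMaxima π ↔ ∀ x : Fin n, π.SameCycle m x → x ≤ m := by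
  simp [cycleMaxima]

theorem mem_thetaList {n : ℕ} (π : Equiv.Perm (Fin n)) (x : Fin n) : x ∈ thetaList π := by
  obtain ⟨m, hm, hmax⟩ := (Finset.univ.filter fun y => π.SameCycle x y).exists_max_image id
    ⟨x, by simpa using Equiv.Perm.SameCycle.refl π x⟩
  have hxm : π.SameCycle x m := by simpa using hm
  refine List.mem_flatMap.2 ⟨m, (mem_cycleMaxima π m).2 fun y hy => ?_, ?_⟩
  · exact hmax y (by simpa using hxm.trans hy)
  · exact (mem_cycleFrom π m x).2 hxm.symm

theorem nodup_thetaList {n : ℕ} (π : Equiv.Perm (Fin n)) : (thetaList π).Nodup := by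
  refine List.nodup_flatMap.2 ⟨fun m _ => nodup_cycleFrom π m, ?_⟩
  have hnd : (cycleMaxima π).Nodup := (List.nodup_finRange n).filter _
  refine hnd.imp_of_mem fun {a b} ha hb hab => ?_
  intro x hxa hxb
  rw [mem_cycleFrom] at hxa hxb
  have hs := hxa.trans hxb.symm
  exact hab (le_antisymm ((mem_cycleMaxima π b).1 hb a hs.symm)
    ((mem_cycleMaxima π a).1 ha b hs))

theorem length_thetaList {n : ℕ} (π : Equiv.Perm (Fin n)) : (thetaList π).length = n := by
  have h := Fintype.card_congr
    ((nodup_thetaList π).getEquivOfForallMemList _ (mem_thetaList π))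
  simpa using h

/-- The fundamental bijection `θ`: the permutation whose one-line notation is the standard cycle
notation of `π` without the parentheses. -/
def theta {n : ℕ} (π : Equiv.Perm (Fin n)) : Equiv.Perm (Fin n) :=
  (finCongr (length_thetaList π).symm).trans
    ((nodup_thetaList π).getEquivOfForallMemList _ (mem_thetaList π))

end CyclicAvoid

/-! A cyclic `π` is the same as a word `τ`: write its cycle starting from the maximum `n` and drop
that letter. The arcs `x ↦ π x` are then the adjacent pairs of the cyclic word `n τ₁ … τₙ₋₁`.

Without fixed points, a `321` is the same as two nested arcs in one direction, `x < y < π y < π x`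
or `π y < π x < x < y` (`contains_321_iff_nested`): the middle letter of a `321` lies on the inner
arc, and conversely pigeonhole supplies the third letter.

Two nested arcs avoiding `n` are disjoint adjacent pairs of `τ`. The direction and the order of the
pairs in the word give the four patterns of length 4. The arc into or out of `n` can only be the
outer one, which gives `p23_1` and `p1_32`. -/

open Equiv

namespace CyclicAvoid

/-! ### Cyclic permutations as words following the maximum -/

/-- The permutation whose one-line notation is that of `τ`, preceded by a new largest letter. -/
def prependMax {m : ℕ} (τ : Perm (Fin m)) : Perm (Fin (m + 1)) :=
  (finSuccEquiv m).trans (τ.optionCongr.trans finSuccEquivLast.symm)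

@[simp]
theorem prependMax_zero {m : ℕ} (τ : Perm (Fin m)) : prependMax τ 0 = Fin.last m := by
  simp [prependMax]

@[simp]
theorem prependMax_succ {m : ℕ} (τ : Perm (Fin m)) (i : Fin m) :
    prependMax τ i.succ = (τ i).castSucc := by
  simp [prependMax]

theorem prependMax_injective {m : ℕ} :
    Function.Injective (prependMax : Perm (Fin m) → Perm (Fin (m + 1))) := by
  intro τ τ' h
  ext1 i
  have := congrArg (fun σ : Perm (Fin (m + 1)) => σ i.succ) h
  simpa using this

theorem exists_prependMax_eq {m : ℕ} {σ : Perm (Fin (m + 1))} (h : σ 0 = Fin.last m) :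
    ∃ τ, prependMax τ = σ := by
  have hne (i : Fin m) : σ i.succ ≠ Fin.last m := by
    rw [← h]
    exact fun hi => Fin.succ_ne_zero i (σ.injective hi)
  have hinj : Function.Injective fun i : Fin m => (σ i.succ).castPred (hne i) := by
    intro i j hij
    simpa using hij
  refine ⟨Equiv.ofBijective _ (Finite.injective_iff_bijective.1 hinj), ?_⟩
  ext1 i
  cases i using Fin.cases with
  | zero => simp [h]
  | succ i => simp

theorem oneLine_prependMax {m : ℕ} (τ : Perm (Fin m)) :
    oneLine (prependMax τ) = (m + 1) :: oneLine τ := by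
  simp [oneLine, List.ofFn_succ]

/-- The cyclic permutation whose cycle notation is `(m + 1, τ₁, …, τₘ)`. -/
def cyclicOf {m : ℕ} (τ : Perm (Fin m)) : Perm (Fin (m + 1)) :=
  prependMax τ * finRotate (m + 1) * (prependMax τ)⁻¹

theorem cyclicOf_prependMax {m : ℕ} (τ : Perm (Fin m)) (i : Fin (m + 1)) :
    cyclicOf τ (prependMax τ i) = prependMax τ (finRotate (m + 1) i) := by
  simp [cyclicOf]

theorem isCyclic_cyclicOf {m : ℕ} (τ : Perm (Fin (m + 1))) : IsCyclic (cyclicOf τ) := by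
  have h : (finRotate (m + 2)).IsCycleOn Set.univ := by
    have := isCycle_finRotate (n := m) |>.isCycleOn
    simpa [Set.eq_univ_iff_forall, ← Perm.mem_support] using this
  have := h.conj (g := prependMax τ)
  simpa [IsCyclic, cyclicOf] using this

/-- A single cycle has a single maximum, so the standard notation is just the orbit of the largest
element. -/
theorem theta_apply_of_isCyclic {m : ℕ} {π : Perm (Fin (m + 2))} (hπ : IsCyclic π)
    (i : Fin (m + 2)) : theta π i = (π ^ (i : ℕ)) (Fin.last (m + 1)) := by
  have hsame (x y) : π.SameCycle x y := hπ.2 (Set.mem_univ x) (Set.mem_univ y)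
  have hmax : cycleMaxima π = [Fin.last (m + 1)] := by
    refine List.perm_singleton.1 ((List.perm_ext_iff_of_nodup
      ((List.nodup_finRange _).filter _) (List.nodup_singleton _)).2 fun x => ?_)
    rw [← cycleMaxima, mem_cycleMaxima, List.mem_singleton]
    exact ⟨fun h => le_antisymm (Fin.le_last x) (h _ (hsame _ _)),
      fun h y _ => h ▸ Fin.le_last y⟩
  have hfix : π (Fin.last (m + 1)) ≠ Fin.last (m + 1) := fun h => by
    have := (hsame (Fin.last (m + 1)) 0).eq_of_left h
    simp [Fin.ext_iff] at this
  have hlist : thetaList π = π.toList (Fin.last (m + 1)) := by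
    simp [thetaList, hmax, cycleFrom, hfix]
  simp [theta, List.Nodup.getEquivOfForallMemList, hlist, Perm.getElem_toList]

theorem theta_cyclicOf {m : ℕ} (τ : Perm (Fin (m + 1))) :
    theta (cyclicOf τ) = prependMax τ := by
  have key (k : ℕ) (hk : k < m + 2) :
      (cyclicOf τ ^ k) (Fin.last (m + 1)) = prependMax τ ⟨k, hk⟩ := by
    induction k with
    | zero => exact (prependMax_zero τ).symm
    | succ k ih =>
      rw [pow_succ', Perm.mul_apply, ih (by omega), cyclicOf_prependMax,
        finRotate_of_lt (by omega)]
  ext1 i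
  rw [theta_apply_of_isCyclic (isCyclic_cyclicOf τ), key i i.2]

theorem exists_cyclicOf_eq {m : ℕ} {π : Perm (Fin (m + 2))} (hπ : IsCyclic π) :
    ∃ τ, cyclicOf τ = π := by
  obtain ⟨τ, hτ⟩ := exists_prependMax_eq (σ := theta π)
    (by rw [theta_apply_of_isCyclic hπ]; simp)
  refine ⟨τ, ?_⟩
  ext1 x
  obtain ⟨i, rfl⟩ := (prependMax τ).surjective x
  rw [cyclicOf_prependMax, hτ, theta_apply_of_isCyclic hπ, theta_apply_of_isCyclic hπ,
    ← Perm.mul_apply, ← pow_succ']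
  cases i using Fin.lastCases with
  -- Wrap-around: the full power of the cycle returns to the maximum.
  | last =>
    have := Perm.IsCycleOn.pow_card_apply (f := π) (s := Finset.univ) (a := Fin.last (m + 1))
      (by simpa [IsCyclic] using hπ) (Finset.mem_univ _)
    rw [Finset.card_univ, Fintype.card_fin] at this
    simp [this]
  | cast i => simp

theorem cyclicOf_injective {m : ℕ} :
    Function.Injective (cyclicOf : Perm (Fin (m + 1)) → Perm (Fin (m + 2))) := by
  intro τ τ' h
  apply prependMax_injective
  rw [← theta_cyclicOf, h, theta_cyclicOf]

/-- This and the next two lemmas cover the three kinds of arcs: out of the maximum, between adjacent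
letters of `τ`, and into the maximum. -/
theorem cyclicOf_last {m : ℕ} (τ : Perm (Fin (m + 1))) :
    cyclicOf τ (Fin.last (m + 1)) = (τ 0).castSucc := by
  rw [← prependMax_zero τ, cyclicOf_prependMax, ← prependMax_succ]
  simp

theorem cyclicOf_castSucc {m : ℕ} (τ : Perm (Fin (m + 1))) {i j : Fin (m + 1)}
    (h : (j : ℕ) = i + 1) : cyclicOf τ (τ i).castSucc = (τ j).castSucc := by
  rw [← prependMax_succ τ i, cyclicOf_prependMax, ← prependMax_succ]
  congr 1
  have hi : i.succ ≠ Fin.last (m + 1) := by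
    rw [Fin.ne_iff_vne, Fin.val_succ, Fin.val_last]
    omega
  rw [Fin.ext_iff, coe_finRotate_of_ne_last hi, Fin.val_succ, Fin.val_succ, h]

theorem cyclicOf_castSucc_last {m : ℕ} (τ : Perm (Fin (m + 1))) :
    cyclicOf τ (τ (Fin.last m)).castSucc = Fin.last (m + 1) := by
  rw [← prependMax_succ τ, cyclicOf_prependMax, ← prependMax_zero τ]
  simp

/-! ### Avoiding `321` means having no nested ascents or descents `x ↦ π x` -/

/-- Pigeonhole: otherwise `π⁻¹` would map `Iic y` into itself and miss `y`, hence into the smaller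
set `Iio y`. -/
theorem exists_apply_le_of_lt_apply {n : ℕ} {π : Perm (Fin n)} {y : Fin n} (h : y < π y) :
    ∃ z, y < z ∧ π z ≤ y := by
  by_contra! hc
  have hsub : (Finset.Iic y).map π.symm.toEmbedding ⊆ Finset.Iio y := by
    intro x hx
    obtain ⟨w, hw, rfl⟩ := Finset.mem_map.1 hx
    have hw : w ≤ y := by simpa using hw
    simp only [Equiv.coe_toEmbedding, Finset.mem_Iio]
    by_contra! hle
    rcases hle.lt_or_eq with hlt | heq
    · exact absurd (hc _ hlt) (by simpa using hw)
    · rw [heq] at h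
      simp only [apply_symm_apply] at h
      exact absurd (heq ▸ h) (by simpa using hw)
  have := Finset.card_le_card hsub
  simp at this

theorem exists_le_apply_of_apply_lt {n : ℕ} {π : Perm (Fin n)} {y : Fin n} (h : π y < y) :
    ∃ z, z < y ∧ y ≤ π z := by
  by_contra! hc
  have hsub : (Finset.Iic y).map π.toEmbedding ⊆ Finset.Iio y := by
    intro x hx
    obtain ⟨w, hw, rfl⟩ := Finset.mem_map.1 hx
    have hw : w ≤ y := by simpa using hw
    simp only [Equiv.coe_toEmbedding, Finset.mem_Iio]
    rcases hw.lt_or_eq with hlt | rfl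
    · exact hc _ hlt
    · exact h
  have := Finset.card_le_card hsub
  simp at this

theorem contains_321_iff {n : ℕ} (π : Perm (Fin n)) :
    Contains π ![3, 2, 1] ↔ ∃ x y z, x < y ∧ y < z ∧ π y < π x ∧ π z < π y := by
  constructor
  · rintro ⟨e, he, ho⟩
    exact ⟨e 0, e 1, e 2, he (by decide), he (by decide), (ho 1 0).2 (by simp),
      (ho 2 1).2 (by simp)⟩
  · rintro ⟨x, y, z, hxy, hyz, h1, h2⟩
    refine ⟨![x, y, z], Fin.strictMono_iff_lt_succ.2 fun i => ?_, fun r s => ?_⟩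
    · fin_cases i <;> simp [*]
    · fin_cases r <;> fin_cases s <;> simp <;> order

/-- The middle position `y` of a `321` is not fixed: if `y < π y` it nests with the left position,
otherwise with the right one. -/
theorem contains_321_iff_nested {n : ℕ} {π : Perm (Fin n)} (hfix : ∀ x, π x ≠ x) :
    Contains π ![3, 2, 1] ↔
      (∃ x y, x < y ∧ y < π y ∧ π y < π x) ∨ ∃ x y, π y < π x ∧ π x < x ∧ x < y := by
  rw [contains_321_iff]
  constructor
  · rintro ⟨x, y, z, hxy, hyz, h1, h2⟩
    rcases lt_or_gt_of_ne (hfix y) with h | h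
    · exact Or.inr ⟨y, z, h2, h, hyz⟩
    · exact Or.inl ⟨x, y, hxy, h, h1⟩
  · rintro (⟨x, y, hxy, h, h1⟩ | ⟨x, y, h1, h, hxy⟩)
    · obtain ⟨z, hz, hz'⟩ := exists_apply_le_of_lt_apply h
      exact ⟨x, y, z, hxy, hz, h1, hz'.trans_lt h⟩
    · obtain ⟨z, hz, hz'⟩ := exists_le_apply_of_apply_lt h
      exact ⟨z, x, y, hz, hxy, h.trans_le hz', h1⟩

/-! ### The vincular patterns, spelled out -/

theorem containsVincular_pairs_iff {n : ℕ} (τ : Perm (Fin n)) (p : VincularPattern 4)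
    (hadj : p.adj = {0, 2}) (hf : p.first = false) (hl : p.last = false) :
    ContainsVincular τ p ↔ ∃ a b c d : Fin n, (b : ℕ) = a + 1 ∧ (d : ℕ) = c + 1 ∧ b < c ∧
      ∀ r s : Fin 4, τ (![a, b, c, d] r) < τ (![a, b, c, d] s) ↔ p.word r < p.word s := by
  constructor
  · rintro ⟨e, ⟨he, ho⟩, ha, -, -⟩
    refine ⟨e 0, e 1, e 2, e 3, ha 0 1 (by simp) (by simp [hadj]),
      ha 2 3 (by simp) (by simp [hadj]), he (by decide), fun r s => ?_⟩
    have : ![e 0, e 1, e 2, e 3] = e := by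
      ext i; fin_cases i <;> rfl
    rw [this, ho]
  · rintro ⟨a, b, c, d, hb, hd, hbc, ho⟩
    refine ⟨![a, b, c, d], ⟨Fin.strictMono_iff_lt_succ.2 fun i => ?_, ho⟩, ?_, by simp [hf],
      by simp [hl]⟩
    · fin_cases i
      · exact Fin.lt_def.2 (by simp [hb])
      · exact hbc
      · exact Fin.lt_def.2 (by simp [hd])
    · intro r s hs hr
      rw [hadj] at hr
      fin_cases r <;> fin_cases s <;> simp_all

theorem containsVincular_p32_41_iff {n : ℕ} (τ : Perm (Fin n)) :
    ContainsVincular τ p32_41 ↔ ∃ a b c d : Fin n, (b : ℕ) = a + 1 ∧ (d : ℕ) = c + 1 ∧ b < c ∧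
      τ d < τ b ∧ τ b < τ a ∧ τ a < τ c := by
  rw [containsVincular_pairs_iff τ _ rfl rfl rfl]
  refine exists₄_congr fun a b c d => and_congr_right' (and_congr_right' (and_congr_right' ?_))
  constructor
  · exact fun h => ⟨(h 3 1).2 (by decide), (h 1 0).2 (by decide), (h 0 2).2 (by decide)⟩
  · rintro ⟨h1, h2, h3⟩ r s
    fin_cases r <;> fin_cases s <;> simp [p32_41] <;> order

theorem containsVincular_p14_23_iff {n : ℕ} (τ : Perm (Fin n)) :
    ContainsVincular τ p14_23 ↔ ∃ a b c d : Fin n, (b : ℕ) = a + 1 ∧ (d : ℕ) = c + 1 ∧ b < c ∧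
      τ a < τ c ∧ τ c < τ d ∧ τ d < τ b := by
  rw [containsVincular_pairs_iff τ _ rfl rfl rfl]
  refine exists₄_congr fun a b c d => and_congr_right' (and_congr_right' (and_congr_right' ?_))
  constructor
  · exact fun h => ⟨(h 0 2).2 (by decide), (h 2 3).2 (by decide), (h 3 1).2 (by decide)⟩
  · rintro ⟨h1, h2, h3⟩ r s
    fin_cases r <;> fin_cases s <;> simp [p14_23] <;> order

theorem containsVincular_p41_32_iff {n : ℕ} (τ : Perm (Fin n)) :
    ContainsVincular τ p41_32 ↔ ∃ a b c d : Fin n, (b : ℕ) = a + 1 ∧ (d : ℕ) = c + 1 ∧ b < c ∧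
      τ b < τ d ∧ τ d < τ c ∧ τ c < τ a := by
  rw [containsVincular_pairs_iff τ _ rfl rfl rfl]
  refine exists₄_congr fun a b c d => and_congr_right' (and_congr_right' (and_congr_right' ?_))
  constructor
  · exact fun h => ⟨(h 1 3).2 (by decide), (h 3 2).2 (by decide), (h 2 0).2 (by decide)⟩
  · rintro ⟨h1, h2, h3⟩ r s
    fin_cases r <;> fin_cases s <;> simp [p41_32] <;> order

theorem containsVincular_p23_14_iff {n : ℕ} (τ : Perm (Fin n)) :
    ContainsVincular τ p23_14 ↔ ∃ a b c d : Fin n, (b : ℕ) = a + 1 ∧ (d : ℕ) = c + 1 ∧ b < c ∧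
      τ c < τ a ∧ τ a < τ b ∧ τ b < τ d := by
  rw [containsVincular_pairs_iff τ _ rfl rfl rfl]
  refine exists₄_congr fun a b c d => and_congr_right' (and_congr_right' (and_congr_right' ?_))
  constructor
  · exact fun h => ⟨(h 2 0).2 (by decide), (h 0 1).2 (by decide), (h 1 3).2 (by decide)⟩
  · rintro ⟨h1, h2, h3⟩ r s
    fin_cases r <;> fin_cases s <;> simp [p23_14] <;> order

theorem containsVincular_p23_1_iff {m : ℕ} (τ : Perm (Fin (m + 1))) :
    ContainsVincular τ p23_1 ↔ ∃ a b : Fin (m + 1), (b : ℕ) = a + 1 ∧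
      τ (Fin.last m) < τ a ∧ τ a < τ b := by
  constructor
  · rintro ⟨e, ⟨he, ho⟩, ha, -, hl⟩
    have h2 : e 2 = Fin.last m := by
      have := hl rfl 2 rfl
      rw [Fin.ext_iff, Fin.val_last]
      omega
    exact ⟨e 0, e 1, ha 0 1 (by simp) (by simp [p23_1]), h2 ▸ (ho 2 0).2 (by decide),
      (ho 0 1).2 (by decide)⟩
  · rintro ⟨a, b, hb, h1, h2⟩
    -- The value at `b` exceeds the last value, so the adjacent pair automatically ends before the
    -- last position.
    have hbl : b ≠ Fin.last m := by
      rintro rfl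
      order
    have hbl := Fin.lt_last_iff_ne_last.2 hbl
    refine ⟨![a, b, Fin.last m], ⟨Fin.strictMono_iff_lt_succ.2 fun i => ?_, fun r s => ?_⟩,
      fun r s hs hr => ?_, by simp [p23_1], fun _ r hr => ?_⟩
    · fin_cases i
      · simp [Fin.lt_def, hb]
      · simpa using hbl
    · fin_cases r <;> fin_cases s <;> simp [p23_1] <;> order
    · have hr : (r : ℕ) = 0 := by simpa [p23_1] using hr
      obtain rfl : r = 0 := Fin.ext hr
      obtain rfl : s = 1 := Fin.ext (by simpa using hs)
      simpa using hb
    · obtain rfl : r = 2 := Fin.ext (by simpa using hr)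
      simp

theorem containsVincular_p1_32_iff {m : ℕ} (τ : Perm (Fin (m + 1))) :
    ContainsVincular τ p1_32 ↔ ∃ a b : Fin (m + 1), (b : ℕ) = a + 1 ∧
      τ 0 < τ b ∧ τ b < τ a := by
  constructor
  · rintro ⟨e, ⟨he, ho⟩, ha, hf, -⟩
    have h0 : e 0 = 0 := Fin.ext (hf rfl 0 rfl)
    exact ⟨e 1, e 2, ha 1 2 (by simp) (by simp [p1_32]), h0 ▸ (ho 0 2).2 (by decide),
      (ho 2 1).2 (by decide)⟩
  · rintro ⟨a, b, hb, h1, h2⟩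
    have ha : a ≠ 0 := by
      rintro rfl
      order
    have ha := Fin.pos_iff_ne_zero.2 ha
    refine ⟨![0, a, b], ⟨Fin.strictMono_iff_lt_succ.2 fun i => ?_, fun r s => ?_⟩,
      fun r s hs hr => ?_, fun _ r hr => ?_, by simp [p1_32]⟩
    · fin_cases i
      · simpa using ha
      · simp [Fin.lt_def, hb]
    · fin_cases r <;> fin_cases s <;> simp [p1_32] <;> order
    · have hr : (r : ℕ) = 1 := by simpa [p1_32] using hr
      obtain rfl : r = 1 := Fin.ext hr
      obtain rfl : s = 2 := Fin.ext (by simpa using hs)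
      simpa using hb
    · obtain rfl : r = 0 := Fin.ext (by simpa using hr)
      simp

/-! ### Nested ascents and descents of `cyclicOf τ` -/

/-- The inner arc ends below the end of the outer one, so only the outer arc can enter the maximum;
this is the case of `p23_1`. Neither ascent starts at the maximum. -/
theorem cyclicOf_nested_ascents_iff {m : ℕ} (τ : Perm (Fin (m + 1))) :
    (∃ x y, x < y ∧ y < cyclicOf τ y ∧ cyclicOf τ y < cyclicOf τ x) ↔
      ContainsVincular τ p14_23 ∨ ContainsVincular τ p23_14 ∨ ContainsVincular τ p23_1 := by
  rw [containsVincular_p14_23_iff, containsVincular_p23_14_iff, containsVincular_p23_1_iff]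
  constructor
  · rintro ⟨x, y, hxy, hy, hyx⟩
    obtain ⟨y, rfl⟩ := Fin.exists_castSucc_eq.2 (hy.trans_le (Fin.le_last _)).ne
    obtain ⟨x, rfl⟩ := Fin.exists_castSucc_eq.2 (hxy.trans_le (Fin.le_last _)).ne
    obtain ⟨c, rfl⟩ := τ.surjective y
    obtain ⟨a, rfl⟩ := τ.surjective x
    have hc : c ≠ Fin.last m := by
      rintro rfl
      rw [cyclicOf_castSucc_last] at hyx
      exact hyx.not_ge (Fin.le_last _)
    obtain ⟨d, hd⟩ : ∃ d : Fin (m + 1), (d : ℕ) = c + 1 :=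
      ⟨⟨c + 1, by have := Fin.val_lt_last hc; omega⟩, rfl⟩
    rw [cyclicOf_castSucc τ hd] at hy hyx
    simp only [Fin.castSucc_lt_castSucc_iff] at hxy hy
    by_cases ha : a = Fin.last m
    · subst ha
      exact Or.inr (Or.inr ⟨c, d, hd, hxy, hy⟩)
    obtain ⟨b, hb⟩ : ∃ b : Fin (m + 1), (b : ℕ) = a + 1 :=
      ⟨⟨a + 1, by have := Fin.val_lt_last ha; omega⟩, rfl⟩
    rw [cyclicOf_castSucc τ hb, Fin.castSucc_lt_castSucc_iff] at hyx
    -- The values satisfy `τ a < τ c < τ d < τ b`, so the pairs `a, b` and `c, d` share no position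
    -- and one lies wholly before the other.
    have hac : (a : ℕ) ≠ c := by
      rw [← Fin.ext_iff.ne]; rintro rfl; order
    have hbc : (b : ℕ) ≠ c := by
      rw [← Fin.ext_iff.ne]; rintro rfl; order
    have hda : (d : ℕ) ≠ a := by
      rw [← Fin.ext_iff.ne]; rintro rfl; order
    rcases lt_or_gt_of_ne hac with h | h
    · exact Or.inl ⟨a, b, c, d, hb, hd, Fin.lt_def.2 (by omega), hxy, hy, hyx⟩
    · exact Or.inr (Or.inl ⟨c, d, a, b, hd, hb, Fin.lt_def.2 (by omega), hxy, hy, hyx⟩)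
  · rintro (⟨a, b, c, d, hb, hd, -, h1, h2, h3⟩ | ⟨c, d, a, b, hd, hb, -, h1, h2, h3⟩ |
      ⟨c, d, hd, h1, h2⟩)
    · refine ⟨(τ a).castSucc, (τ c).castSucc, ?_⟩
      simp [cyclicOf_castSucc τ hb, cyclicOf_castSucc τ hd, *]
    · refine ⟨(τ a).castSucc, (τ c).castSucc, ?_⟩
      simp [cyclicOf_castSucc τ hb, cyclicOf_castSucc τ hd, *]
    · refine ⟨(τ (Fin.last m)).castSucc, (τ c).castSucc, ?_⟩
      simp [cyclicOf_castSucc τ hd, cyclicOf_castSucc_last, Fin.castSucc_lt_last, *]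

/-- Dually, no descent enters the maximum, and only the outer one can leave it; its other end is
then the first letter of `τ`, as in `p1_32`. -/
theorem cyclicOf_nested_descents_iff {m : ℕ} (τ : Perm (Fin (m + 1))) :
    (∃ x y, cyclicOf τ y < cyclicOf τ x ∧ cyclicOf τ x < x ∧ x < y) ↔
      ContainsVincular τ p32_41 ∨ ContainsVincular τ p41_32 ∨ ContainsVincular τ p1_32 := by
  rw [containsVincular_p32_41_iff, containsVincular_p41_32_iff, containsVincular_p1_32_iff]
  constructor
  · rintro ⟨x, y, hyx, hx, hxy⟩
    obtain ⟨x, rfl⟩ := Fin.exists_castSucc_eq.2 (hxy.trans_le (Fin.le_last _)).ne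
    obtain ⟨a, rfl⟩ := τ.surjective x
    have ha : a ≠ Fin.last m := by
      rintro rfl
      rw [cyclicOf_castSucc_last] at hx
      exact hx.not_ge (Fin.le_last _)
    obtain ⟨b, hb⟩ : ∃ b : Fin (m + 1), (b : ℕ) = a + 1 :=
      ⟨⟨a + 1, by have := Fin.val_lt_last ha; omega⟩, rfl⟩
    rw [cyclicOf_castSucc τ hb] at hx hyx
    rw [Fin.castSucc_lt_castSucc_iff] at hx
    cases y using Fin.lastCases with
    | last =>
      rw [cyclicOf_last, Fin.castSucc_lt_castSucc_iff] at hyx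
      exact Or.inr (Or.inr ⟨a, b, hb, hyx, hx⟩)
    | cast y =>
    obtain ⟨c, rfl⟩ := τ.surjective y
    rw [Fin.castSucc_lt_castSucc_iff] at hxy
    have hc : c ≠ Fin.last m := by
      rintro rfl
      rw [cyclicOf_castSucc_last] at hyx
      exact hyx.not_ge (Fin.le_last _)
    obtain ⟨d, hd⟩ : ∃ d : Fin (m + 1), (d : ℕ) = c + 1 :=
      ⟨⟨c + 1, by have := Fin.val_lt_last hc; omega⟩, rfl⟩
    rw [cyclicOf_castSucc τ hd, Fin.castSucc_lt_castSucc_iff] at hyx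
    have hac : (a : ℕ) ≠ c := by
      rw [← Fin.ext_iff.ne]; rintro rfl; order
    have hbc : (b : ℕ) ≠ c := by
      rw [← Fin.ext_iff.ne]; rintro rfl; order
    have hda : (d : ℕ) ≠ a := by
      rw [← Fin.ext_iff.ne]; rintro rfl; order
    rcases lt_or_gt_of_ne hac with h | h
    · exact Or.inl ⟨a, b, c, d, hb, hd, Fin.lt_def.2 (by omega), hyx, hx, hxy⟩
    · exact Or.inr (Or.inl ⟨c, d, a, b, hd, hb, Fin.lt_def.2 (by omega), hyx, hx, hxy⟩)
  · rintro (⟨a, b, c, d, hb, hd, -, h1, h2, h3⟩ | ⟨c, d, a, b, hd, hb, -, h1, h2, h3⟩ |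
      ⟨a, b, hb, h1, h2⟩)
    · refine ⟨(τ a).castSucc, (τ c).castSucc, ?_⟩
      simp [cyclicOf_castSucc τ hb, cyclicOf_castSucc τ hd, *]
    · refine ⟨(τ a).castSucc, (τ c).castSucc, ?_⟩
      simp [cyclicOf_castSucc τ hb, cyclicOf_castSucc τ hd, *]
    · refine ⟨(τ a).castSucc, Fin.last (m + 1), ?_⟩
      simp [cyclicOf_castSucc τ hb, cyclicOf_last, Fin.castSucc_lt_last, *]

/-! ### The bijection between the two classes -/

theorem IsCyclic.apply_ne_self {m : ℕ} {π : Perm (Fin (m + 2))} (hπ : IsCyclic π)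
    (x : Fin (m + 2)) : π x ≠ x :=
  hπ.apply_ne Set.nontrivial_univ (Set.mem_univ x)

theorem cyclicOf_mem_cyclicAvoid321_iff {m : ℕ} (τ : Perm (Fin (m + 1))) :
    cyclicOf τ ∈ cyclicAvoid321 (m + 2) ↔ τ ∈ avoidSix (m + 1) := by
  have hc := isCyclic_cyclicOf τ
  simp only [cyclicAvoid321, avoidSix, Set.mem_ofPred_eq, hc, true_and,
    contains_321_iff_nested hc.apply_ne_self, cyclicOf_nested_ascents_iff,
    cyclicOf_nested_descents_iff]
  tauto

/-- Prepending `n` and reading the word as a cycle, as a bijection between the two classes. -/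
noncomputable def avoidSixEquiv (m : ℕ) : avoidSix (m + 1) ≃ cyclicAvoid321 (m + 2) :=
  Equiv.ofBijective
    (fun τ => ⟨cyclicOf (τ : Perm (Fin (m + 1))), (cyclicOf_mem_cyclicAvoid321_iff _).2 τ.2⟩)
    ⟨fun _ _ h => Subtype.ext (cyclicOf_injective (congrArg Subtype.val h)), fun ⟨π, hπ⟩ => by
      obtain ⟨τ, rfl⟩ := exists_cyclicOf_eq hπ.1
      exact ⟨⟨τ, (cyclicOf_mem_cyclicAvoid321_iff τ).1 hπ⟩, rfl⟩⟩

end CyclicAvoid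

theorem corollary3p2 (n : ℕ) (hn : 2 ≤ n) :
    Nat.card (CyclicAvoid.cyclicAvoid321 n) = Nat.card (CyclicAvoid.avoidSix (n - 1)) ∧
    ∃ f : CyclicAvoid.cyclicAvoid321 n → CyclicAvoid.avoidSix (n - 1),
      Function.Bijective f ∧
      ∀ π : CyclicAvoid.cyclicAvoid321 n,
        CyclicAvoid.oneLine (CyclicAvoid.theta (π : Equiv.Perm (Fin n))) =
          n :: CyclicAvoid.oneLine (f π : Equiv.Perm (Fin (n - 1))) := by
  obtain ⟨m, rfl⟩ := Nat.exists_eq_add_of_le' hn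
  refine ⟨Nat.card_congr (CyclicAvoid.avoidSixEquiv m).symm,
    (CyclicAvoid.avoidSixEquiv m).symm, (CyclicAvoid.avoidSixEquiv m).symm.bijective, fun π => ?_⟩
  -- With `π` written as `cyclicOf τ`, the map returns `τ`, while `theta` returns `τ` preceded by
  -- the maximum.
  obtain ⟨τ, rfl⟩ := (CyclicAvoid.avoidSixEquiv m).surjective π
  rw [Equiv.symm_apply_apply]
  exact (congrArg CyclicAvoid.oneLine (CyclicAvoid.theta_cyclicOf τ.1)).trans
    (CyclicAvoid.oneLine_prependMax τ.1)
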